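/- For a discrete group $G$ let $u_g$, $g\in G$, be the shift operators on $\ell^2(G)$, $u_g\delta_h=\delta_{gh}$, let $L(G)\subseteq B(\ell^2(G))$ be the von Neumann algebra they generate, and let $\tau(x)=\langle\delta_e,x\delta_e\rangle$ be the canonical trace on $L(G)$. For a subgroup $N\le G$, $L(N)$ is identified with the von Neumann subalgebra of $L(G)$ generated by $u_g$, $g\in N$. A von Neumann subalgebra $\mathcal M\subseteq L(G)$ is invariant if $u_g\mathcal M u_g^*\subseteq\mathcal M$ for all $g\in G$. Let $\mathbb N=\{1,2,\dots\}$, let $S_\infty$ be the group of finitely supported permutations of $\mathbb N$, acting on $\mathbb Z_2^\infty=\bigoplus_{\mathbb N}\mathbb Z_2$ by permuting the coordinates, and let $G=S_\infty\ltimes\mathbb Z_2^\infty$; write $s$ also for $u_s\in L(G)$. Fix an orthogonal projection $Q\in L(\mathbb Z_2)$ with $Q\ne 0$ and $Q\neq 1$. For $n\in\mathbb N$ let $Q^{(n)}\in L(G)$ be the copy of $Q$ inside $L(\mathbb Z_2^{(n)})$, where $\mathbb Z_2^{(n)}\subseteq\mathbb Z_2^\infty$ is the $n$-th coordinate subgroup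 (that is, the image of $Q$ under the isomorphism $u_z\mapsto u_{z^{(n)}}$), and for a finite set $A\subset\mathbb N$ put $Q^A=\prod_{n\in A}Q^{(n)}$ (so $Q^\varnothing=1$). For $s\in S_\infty$ let $\mathrm{supp}(s)=\{n: s(n)\ne n\}$. **Proposition.** Let $\mathcal M_Q$ be the von Neumann algebra generated by $L(\mathbb Z_2^\infty)$ and the elements $s\,Q^{\mathrm{supp}(s)}$, $s\in S_\infty$. Then $\mathcal M_Q$ is an invariant von Neumann subalgebra of $L(G)$, and there is no normal subgroup $N\trianglelefteq G$ with $\mathcal M_Q=L(N)$. Moreover, there is a unique $\tau$-preserving conditional expectation $E:L(G)\to\mathcal M_Q$, and it satisfies $$E\big((12)\big)=(12)\,Q^{\{1,2\}}.$$ -/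

import Mathlib

open scoped ENNReal InnerProductSpace

noncomputable section

namespace GroupVN

section General

/-- The Hilbert space `ℓ²(G)`. -/
abbrev Ell2 (G : Type*) : Type _ := lp (fun _ : G => ℂ) 2

open Classical in
/-- The canonical basis vector `δ_g` of `ℓ²(G)`. -/
def delta {G : Type*} (g : G) : Ell2 G := lp.single 2 g (1 : ℂ)

variable {G : Type*} [Group G]

theorem memlp_shift (g : G) (f : Ell2 G) :
    Memℓp (fun h : G => (f (g⁻¹ * h) : ℂ)) 2 := by
  have h2 : 0 < (2 : ℝ≥0∞).toReal := by norm_num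
  have hf := (memℓp_gen_iff h2).1 (lp.memℓp f)
  exact (memℓp_gen_iff h2).2
    ((Equiv.summable_iff (Equiv.mulLeft g⁻¹) (f := fun h => ‖f h‖ ^ (2 : ℝ≥0∞).toReal)).2 hf)

/-- The shift operator `(u_g f)(h) = f (g⁻¹ h)` on `ℓ²(G)`, so that `u_g δ_h = δ_{gh}`. -/
def shift (g : G) : Ell2 G →L[ℂ] Ell2 G :=
  LinearMap.mkContinuous
    { toFun := fun f => ⟨fun h => f (g⁻¹ * h), memlp_shift g f⟩
      map_add' := fun _ _ => rfl
      map_smul' := fun _ _ => rfl } 1 (fun f => by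
        have h2 : 0 < (2 : ℝ≥0∞).toReal := by norm_num
        rw [one_mul, lp.norm_eq_tsum_rpow h2, lp.norm_eq_tsum_rpow h2]
        exact le_of_eq (congrArg (fun t : ℝ => t ^ (1 / (2 : ℝ≥0∞).toReal))
          ((Equiv.mulLeft g⁻¹).tsum_eq (fun h => ‖f h‖ ^ (2 : ℝ≥0∞).toReal))))

@[simp]
theorem shift_apply (g : G) (f : Ell2 G) (h : G) : shift g f h = f (g⁻¹ * h) := rfl

theorem shift_delta (g h : G) : shift g (delta h) = delta (g * h) := by
  classical
  ext k
  simp only [shift_apply, delta, lp.single_apply, Pi.single_apply, inv_mul_eq_iff_eq_mul]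

/-- The left regular representation `g ↦ u_g`. -/
def regRep (G : Type*) [Group G] : G →* (Ell2 G →L[ℂ] Ell2 G) where
  toFun := shift
  map_one' := by
    ext f h
    simp
  map_mul' g k := by
    ext f h
    simp [mul_assoc]

/-- The von Neumann algebra on `H` generated by a set `S` of bounded operators: the bicommutant of
`S ∪ S*`. -/
def generated {H : Type*} [NormedAddCommGroup H] [InnerProductSpace ℂ H] [CompleteSpace H]
    (S : Set (H →L[ℂ] H)) : VonNeumannAlgebra H where
  toStarSubalgebra :=
    StarSubalgebra.centralizer ℂ (StarSubalgebra.centralizer ℂ S : Set (H →L[ℂ] H))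
  centralizer_centralizer' := by
    change Set.centralizer (Set.centralizer
      ((StarSubalgebra.centralizer ℂ (StarSubalgebra.centralizer ℂ S : Set (H →L[ℂ] H)) :
        Set (H →L[ℂ] H)))) = _
    rw [StarSubalgebra.coe_centralizer]
    exact Set.centralizer_centralizer_centralizer _

theorem subset_generated {H : Type*} [NormedAddCommGroup H] [InnerProductSpace ℂ H]
    [CompleteSpace H] (S : Set (H →L[ℂ] H)) : S ⊆ (generated S : Set (H →L[ℂ] H)) := by
  exact (StarAlgebra.subset_adjoin ℂ S).trans
    (StarAlgebra.adjoin_le_centralizer_centralizer ℂ S)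

theorem generated_le {H : Type*} [NormedAddCommGroup H] [InnerProductSpace ℂ H]
    [CompleteSpace H] {S : Set (H →L[ℂ] H)} {M : VonNeumannAlgebra H}
    (h : S ⊆ (M : Set (H →L[ℂ] H))) : generated S ≤ M := by
  intro x hx
  have hM : S ∪ star S ⊆ (M : Set (H →L[ℂ] H)) :=
    Set.union_subset h fun y hy => by simpa using star_mem (h hy)
  have hx' : x ∈ (S ∪ star S).centralizer.centralizer := by
    rw [← StarSubalgebra.coe_centralizer_centralizer ℂ S]
    exact hx
  have := Set.centralizer_subset (Set.centralizer_subset hM) hx'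
  rwa [VonNeumannAlgebra.centralizer_centralizer] at this

/-- For a subgroup `N` of `G`, the algebra `L(N)`, viewed as a von Neumann subalgebra of `L(G)`. -/
def subgroupVN (N : Subgroup G) : VonNeumannAlgebra (Ell2 G) :=
  generated (regRep G '' (N : Set G))

/-- The group von Neumann algebra `L(G)`. -/
def groupVN (G : Type*) [Group G] : VonNeumannAlgebra (Ell2 G) :=
  generated (Set.range (regRep G))

theorem regRep_mem (g : G) : regRep G g ∈ (groupVN G).toStarSubalgebra :=
  subset_generated _ ⟨g, rfl⟩

/-- The canonical trace `τ(x) = ⟨δ_e, x δ_e⟩`. -/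
def trace (x : Ell2 G →L[ℂ] Ell2 G) : ℂ := ⟪delta (1 : G), x (delta (1 : G))⟫_ℂ

/-- The Fourier coefficient `c_g` of `x = ∑ c_g u_g`, i.e. `x δ_e = ∑ c_g δ_g`. -/
def coeff (x : Ell2 G →L[ℂ] Ell2 G) (g : G) : ℂ := x (delta (1 : G)) g

/-- `M` is invariant under the adjoint action of `G`. -/
def IsInvariant (M : VonNeumannAlgebra (Ell2 G)) : Prop :=
  ∀ g : G, ∀ m ∈ M, regRep G g * m * star (regRep G g) ∈ M

/-- `E : L(G) → M` is a trace-preserving conditional expectation onto `M ⊆ L(G)`. -/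
structure IsCondExp (M : VonNeumannAlgebra (Ell2 G))
    (E : (groupVN G).toStarSubalgebra →ₗ[ℂ] M.toStarSubalgebra) : Prop where
  le : M ≤ groupVN G
  apply_of_mem : ∀ x : (groupVN G).toStarSubalgebra, (x : Ell2 G →L[ℂ] Ell2 G) ∈ M →
    (E x : Ell2 G →L[ℂ] Ell2 G) = x
  bimodule : ∀ (a b : M.toStarSubalgebra) (x y : (groupVN G).toStarSubalgebra),
    (y : Ell2 G →L[ℂ] Ell2 G) = a * x * b → E y = a * E x * b
  nonneg : ∀ x : (groupVN G).toStarSubalgebra, 0 ≤ (x : Ell2 G →L[ℂ] Ell2 G) →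
    0 ≤ (E x : Ell2 G →L[ℂ] Ell2 G)
  trace_apply : ∀ x : (groupVN G).toStarSubalgebra,
    trace (E x : Ell2 G →L[ℂ] Ell2 G) = trace (x : Ell2 G →L[ℂ] Ell2 G)

end General

/-- The group `ℤ₂`, written multiplicatively. -/
abbrev Z2 : Type := Multiplicative (ZMod 2)

/-- The direct sum `ℤ₂^∞ = ⨁_{n ≥ 1} ℤ₂`, written multiplicatively. -/
abbrev Z2Inf : Type := Multiplicative (ℕ+ →₀ ZMod 2)

/-- The group `S_∞` of finitely supported permutations of `{1, 2, 3, …}`. -/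
def SInf : Subgroup (Equiv.Perm ℕ+) where
  carrier := {s | {i | s i ≠ i}.Finite}
  one_mem' := by simp
  mul_mem' {s t} hs ht := by
    refine (hs.union ht).subset fun i hi => ?_
    by_contra h
    simp only [Set.mem_union, Set.mem_ofPred_eq, not_or, not_not] at h
    exact hi (by rw [Equiv.Perm.mul_apply, h.2, h.1])
  inv_mem' {s} hs := by
    refine hs.subset fun i hi h => hi ?_
    rw [Equiv.Perm.inv_eq_iff_eq, h]

/-- The support `{i | s i ≠ i}` of `s ∈ S_∞`. -/
def supp (s : SInf) : Finset ℕ+ := Set.Finite.toFinset (s := {i | s.1 i ≠ i}) s.2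

/-- The transposition `(i j)` as an element of `S_∞`. -/
def transposition (i j : ℕ+) : SInf :=
  ⟨Equiv.swap i j, (Set.toFinite {i, j}).subset fun k hk => by
    by_contra h
    simp only [Set.mem_insert_iff, Set.mem_singleton_iff, not_or] at h
    exact hk (Equiv.swap_apply_of_ne_of_ne h.1 h.2)⟩

/-- The action of `S_∞` on `ℤ₂^∞` permuting the coordinates: the `n`-th coordinate is moved to the
place `s n`. -/
def permAction : SInf →* MulAut Z2Inf where
  toFun s := AddEquiv.toMultiplicative (Finsupp.domCongr (M := ZMod 2) (s : Equiv.Perm ℕ+))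
  map_one' := by
    ext f
    rfl
  map_mul' s t := by
    ext f
    rfl

/-- The group `S_∞ ⋉ ℤ₂^∞`. -/
abbrev WreathInf : Type := Z2Inf ⋊[permAction] SInf

/-- The inclusion `S_∞ → S_∞ ⋉ ℤ₂^∞`. -/
abbrev ofPerm : SInf →* WreathInf := SemidirectProduct.inr

/-- The inclusion `ℤ₂^∞ → S_∞ ⋉ ℤ₂^∞`. -/
abbrev ofSum : Z2Inf →* WreathInf := SemidirectProduct.inl

/-- The inclusion `z ↦ z^{(n)}` of `ℤ₂` in `ℤ₂^∞` as the `n`-th coordinate. -/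
def coord (n : ℕ+) : Z2 →* Z2Inf :=
  AddMonoidHom.toMultiplicative (Finsupp.singleAddHom n)

/-- The copy `Q^{(n)} ∈ L(ℤ₂^{(n)}) ⊆ L(S_∞ ⋉ ℤ₂^∞)` of `Q ∈ L(ℤ₂)`: the image of
`Q = ∑_z c_z u_z` under the isomorphism `u_z ↦ u_{z^{(n)}}`. -/
def copy (Q : Ell2 Z2 →L[ℂ] Ell2 Z2) (n : ℕ+) : Ell2 WreathInf →L[ℂ] Ell2 WreathInf :=
  ∑ z : Z2, coeff Q z • regRep WreathInf (ofSum (coord n z))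

theorem copy_commute (Q : Ell2 Z2 →L[ℂ] Ell2 Z2) (m n : ℕ+) :
    Commute (copy Q m) (copy Q n) := by
  refine Commute.sum_left _ _ _ fun z _ => Commute.sum_right _ _ _ fun w _ => ?_
  refine Commute.smul_left (Commute.smul_right ?_ _) _
  exact ((Commute.all (coord m z) (coord n w)).map ofSum).map (regRep WreathInf)

/-- `Q^A = ∏_{n ∈ A} Q^{(n)}` for a finite set `A`. -/
def power (Q : Ell2 Z2 →L[ℂ] Ell2 Z2) (A : Finset ℕ+) :
    Ell2 WreathInf →L[ℂ] Ell2 WreathInf :=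
  A.noncommProd (copy Q) fun m _ n _ _ => copy_commute Q m n

/-- The von Neumann algebra `M_Q` generated by `L(ℤ₂^∞)` and the operators `s Q^{supp s}`,
`s ∈ S_∞`. -/
def algebraMQ (Q : Ell2 Z2 →L[ℂ] Ell2 Z2) : VonNeumannAlgebra (Ell2 WreathInf) :=
  generated (Set.range (fun s : SInf => regRep WreathInf (ofPerm s) * power Q (supp s)) ∪
    (subgroupVN ofSum.range : Set (Ell2 WreathInf →L[ℂ] Ell2 WreathInf)))

end GroupVN

end

noncomputable section

namespace GroupVN

/-! ### Right shifts and modular conjugation on `ℓ²(G)` -/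

section RegularRepresentation

variable {G : Type*}

/-! An element `x` of `L(G)` commutes with the right shifts, so it is determined by the vector `x
δ_1`, and questions about `M ⊆ L(G)` become questions about the closed subspace `cyclicSpace M` with
projection `e = proj M`.

Conditional expectation: the trace condition and the bimodule property force `E(x) δ_1 = e x δ_1`,
which gives uniqueness. For existence this vector must come from a bounded operator. With `T = e x
e`, the modular conjugation `J` (`flip`) shows that `T` commutes with each `e r_g e`
(`commute_compression`). Hence `r_g δ_1 ↦ r_g T δ_1` is bounded by `‖T‖` (`norm_rightConv_le`), and
its extension lies in `M` by `mem_of_apply_mem_cyclicSpace`.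

The algebra `M_Q`: a nontrivial projection of `L(ℤ₂)` is `(1 ± u)/2`, so the `Q^A` are commuting
projections with `Q^A Q^B = Q^(A ∪ B)`. The product of the generators of `s` and `t` is `Q^(supp s ∪
supp t)` times the generator of `st` (`gen_mul_gen`), so the closed span of the vectors `u_z s
Q^(supp s) δ_1` is stable under the generators and contains `M_Q δ_1`. Different permutations give
orthogonal vectors, and for equal ones `Q^(supp s)` kills `s - s Q^(supp s)`. Thus `s - s Q^(supp
s)` is orthogonal to `M_Q` (`inner_algebraMQ`), which yields the formula for `E`.

If `M_Q = L(N)`, the coefficient `1/4` of `(12) Q^{1,2}` at `(12)` puts `(12)` in `N`, hence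
`u_(12)` in `M_Q`. Orthogonality then gives `1 = 1/4`. -/

theorem inner_delta_left (g : G) (f : Ell2 G) : ⟪delta g, f⟫_ℂ = f g := by
  classical
  simp only [delta]
  convert lp.inner_single_left (𝕜 := ℂ) g (1 : ℂ) f using 1
  · simp

theorem delta_apply [DecidableEq G] (g h : G) : delta g h = if h = g then (1 : ℂ) else 0 := by
  simp only [delta, lp.single_apply, Pi.single_apply]
  congr

theorem span_delta : (Submodule.span ℂ (Set.range (delta (G := G)))).topologicalClosure = ⊤ := by
  rw [Submodule.topologicalClosure_eq_top_iff, Submodule.eq_bot_iff]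
  intro v hv
  ext g
  rw [← inner_delta_left, (Submodule.mem_orthogonal _ _).1 hv _ (Submodule.subset_span ⟨g, rfl⟩)]
  rfl

theorem ext_delta {x y : Ell2 G →L[ℂ] Ell2 G} (h : ∀ g, x (delta g) = y (delta g)) : x = y := by
  refine ContinuousLinearMap.ext_on (s := Set.range (delta (G := G))) ?_ ?_
  · rw [dense_iff_closure_eq, ← Submodule.topologicalClosure_coe, span_delta, Submodule.top_coe]
  · rintro _ ⟨g, rfl⟩
    exact h g

variable [Group G]

theorem inner_shift (g : G) (f f' : Ell2 G) : ⟪shift g f, f'⟫_ℂ = ⟪f, shift g⁻¹ f'⟫_ℂ := by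
  rw [lp.inner_eq_tsum, lp.inner_eq_tsum, ← (Equiv.mulLeft g).tsum_eq]
  simp

theorem star_regRep (g : G) : star (regRep G g) = regRep G g⁻¹ := by
  rw [ContinuousLinearMap.star_eq_adjoint]
  symm
  rw [ContinuousLinearMap.eq_adjoint_iff]
  intro f f'
  rw [show regRep G g⁻¹ = shift g⁻¹ from rfl, inner_shift, inv_inv]
  rfl

theorem regRep_delta (g h : G) : regRep G g (delta h) = delta (g * h) := shift_delta g h

theorem regRep_apply (g : G) (f : Ell2 G) (h : G) : regRep G g f h = f (g⁻¹ * h) := rfl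

theorem memlp_rightShift (g : G) (f : Ell2 G) : Memℓp (fun h : G => (f (h * g) : ℂ)) 2 := by
  have h2 : 0 < (2 : ℝ≥0∞).toReal := by norm_num
  exact (memℓp_gen_iff h2).2 ((Equiv.summable_iff (Equiv.mulRight g)
    (f := fun h => ‖f h‖ ^ (2 : ℝ≥0∞).toReal)).2 ((memℓp_gen_iff h2).1 (lp.memℓp f)))

/-- The right shift operator `(r_g f)(h) = f (h g)`. -/
def rightShift (g : G) : Ell2 G →L[ℂ] Ell2 G :=
  LinearMap.mkContinuous
    { toFun := fun f => ⟨fun h => f (h * g), memlp_rightShift g f⟩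
      map_add' := fun _ _ => rfl
      map_smul' := fun _ _ => rfl } 1 (fun f => by
        have h2 : 0 < (2 : ℝ≥0∞).toReal := by norm_num
        rw [one_mul, lp.norm_eq_tsum_rpow h2, lp.norm_eq_tsum_rpow h2]
        exact le_of_eq (congrArg (fun t : ℝ => t ^ (1 / (2 : ℝ≥0∞).toReal))
          ((Equiv.mulRight g).tsum_eq (fun h => ‖f h‖ ^ (2 : ℝ≥0∞).toReal))))

theorem rightShift_apply (g : G) (f : Ell2 G) (h : G) : rightShift g f h = f (h * g) := rfl

theorem rightShift_delta (g h : G) : rightShift g (delta h) = delta (h * g⁻¹) := by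
  classical
  ext k
  simp only [rightShift_apply, delta_apply, eq_mul_inv_iff_mul_eq]

theorem rightShift_mul (g h : G) : rightShift (g * h) = rightShift g * rightShift h := by
  ext f k
  simp [rightShift_apply, mul_assoc]

theorem rightShift_one : rightShift (1 : G) = 1 := by
  ext f k
  simp [rightShift_apply]

theorem inner_rightShift (g : G) (f f' : Ell2 G) :
    ⟪rightShift g f, f'⟫_ℂ = ⟪f, rightShift g⁻¹ f'⟫_ℂ := by
  rw [lp.inner_eq_tsum, lp.inner_eq_tsum, ← (Equiv.mulRight g⁻¹).tsum_eq]
  simp [rightShift_apply]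

theorem star_rightShift (g : G) : star (rightShift g) = rightShift g⁻¹ := by
  rw [ContinuousLinearMap.star_eq_adjoint]
  symm
  rw [ContinuousLinearMap.eq_adjoint_iff]
  intro f f'
  rw [inner_rightShift, inv_inv]

theorem commute_regRep_rightShift (g h : G) : Commute (regRep G g) (rightShift h) := by
  ext f k
  simp [rightShift_apply, regRep_apply, mul_assoc]

theorem mem_generated_iff {H : Type*} [NormedAddCommGroup H] [InnerProductSpace ℂ H]
    [CompleteSpace H] {S : Set (H →L[ℂ] H)} {x : H →L[ℂ] H} :
    x ∈ generated S ↔ ∀ y : H →L[ℂ] H, (∀ s ∈ S, Commute s y ∧ Commute (star s) y) →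
      Commute y x := by
  have : x ∈ generated S ↔ x ∈ StarSubalgebra.centralizer ℂ
    (StarSubalgebra.centralizer ℂ S : Set (H →L[ℂ] H)) := Iff.rfl
  rw [this, StarSubalgebra.mem_centralizer_iff]
  constructor
  · intro h y hy
    exact (h y (StarSubalgebra.mem_centralizer_iff ℂ |>.2 fun s hs =>
      ⟨(hy s hs).1, (hy s hs).2⟩)).1
  · intro h y hy
    have key : ∀ y ∈ StarSubalgebra.centralizer ℂ S, Commute y x := fun y hy =>
      h y fun s hs => StarSubalgebra.mem_centralizer_iff ℂ |>.1 hy s hs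
    exact ⟨key y hy, key _ (star_mem hy)⟩

/-- Elements of `L(G)` commute with the right shifts. -/
theorem commute_rightShift_of_mem {x : Ell2 G →L[ℂ] Ell2 G} (hx : x ∈ groupVN G) (g : G) :
    Commute x (rightShift g) := by
  refine (mem_generated_iff.1 hx (rightShift g) ?_).symm
  rintro _ ⟨h, rfl⟩
  exact ⟨commute_regRep_rightShift h g, by
    rw [star_regRep]; exact commute_regRep_rightShift h⁻¹ g⟩

theorem commute_rightShift_star {x : Ell2 G →L[ℂ] Ell2 G} (hx : ∀ g, Commute x (rightShift g))
    (g : G) : Commute (star x) (rightShift g) := by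
  rw [← inv_inv g, ← star_rightShift]
  exact (hx g⁻¹).star_star

theorem apply_delta {x : Ell2 G →L[ℂ] Ell2 G} (hx : ∀ g, Commute x (rightShift g)) (g : G) :
    x (delta g) = rightShift g⁻¹ (x (delta 1)) := by
  have := congrArg (fun T => T (delta 1)) (hx g⁻¹).eq
  simpa [rightShift_delta] using this

/-- `δ_1` is separating for the operators commuting with the right shifts. -/
theorem ext_delta_one {x y : Ell2 G →L[ℂ] Ell2 G} (hx : ∀ g, Commute x (rightShift g))
    (hy : ∀ g, Commute y (rightShift g)) (h : x (delta 1) = y (delta 1)) : x = y :=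
  ext_delta fun g => by rw [apply_delta hx, apply_delta hy, h]

theorem memlp_flip (f : Ell2 G) : Memℓp (fun h : G => (star (f h⁻¹) : ℂ)) 2 := by
  have h2 : 0 < (2 : ℝ≥0∞).toReal := by norm_num
  refine (memℓp_gen_iff h2).2 ?_
  simpa using! (Equiv.summable_iff (Equiv.inv G)
    (f := fun h => ‖f h‖ ^ (2 : ℝ≥0∞).toReal)).2 ((memℓp_gen_iff h2).1 (lp.memℓp f))

/-- The modular conjugation `(J f)(h) = conj (f h⁻¹)`. -/
def flip (f : Ell2 G) : Ell2 G := ⟨fun h => star (f h⁻¹), memlp_flip f⟩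

theorem flip_apply (f : Ell2 G) (h : G) : flip f h = star (f h⁻¹) := rfl

theorem inner_flip (f f' : Ell2 G) : ⟪flip f, flip f'⟫_ℂ = ⟪f', f⟫_ℂ := by
  rw [lp.inner_eq_tsum, lp.inner_eq_tsum, ← (Equiv.inv G).tsum_eq]
  simp [flip_apply, mul_comm]

theorem flip_sub (f f' : Ell2 G) : flip (f - f') = flip f - flip f' := by
  ext h
  simp [flip_apply]

theorem norm_flip (f : Ell2 G) : ‖flip f‖ = ‖f‖ := by
  rw [@norm_eq_sqrt_re_inner ℂ, inner_flip, ← @norm_eq_sqrt_re_inner ℂ]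

theorem continuous_flip : Continuous (flip (G := G)) :=
  (Isometry.of_dist_eq fun f f' => by
    rw [dist_eq_norm, dist_eq_norm, ← flip_sub, norm_flip]).continuous

/-- Identifies `J` as the map `x δ_1 ↦ x* δ_1`, so adjoints can be taken on vectors, where the
operation is isometric. -/
theorem star_apply_delta_one {x : Ell2 G →L[ℂ] Ell2 G} (hx : ∀ g, Commute x (rightShift g)) :
    star x (delta 1) = flip (x (delta 1)) := by
  ext g
  rw [← inner_delta_left, ContinuousLinearMap.star_eq_adjoint,
    ContinuousLinearMap.adjoint_inner_right, apply_delta hx, flip_apply, ← inner_conj_symm,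
    inner_delta_left, rightShift_apply, one_mul]
  rfl

theorem flip_delta (g : G) : flip (delta g) = delta g⁻¹ := by
  classical
  ext h
  simp only [flip_apply, delta_apply, inv_eq_iff_eq_inv]
  split_ifs <;> simp

end RegularRepresentation

open scoped ComplexOrder

/-! ### The trace-preserving conditional expectation onto a von Neumann subalgebra -/

section ConditionalExpectation

variable {G : Type*}

theorem star_mul_inner (m : Ell2 G →L[ℂ] Ell2 G) (f f' : Ell2 G) :
    ⟪m f, f'⟫_ℂ = ⟪f, star m f'⟫_ℂ := by
  rw [ContinuousLinearMap.star_eq_adjoint, ContinuousLinearMap.adjoint_inner_right]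

/-- The root comes from the functional calculus of `a`, hence commutes with whatever commutes with
`a`. -/
theorem exists_star_mul_self {A : Type*} [CStarAlgebra A] [PartialOrder A] [StarOrderedRing A]
    {a : A} (ha : 0 ≤ a) : ∃ s : A, star s * s = a ∧ ∀ b, Commute a b → Commute s b :=
  ⟨CFC.sqrt a, by
    rw [(CFC.sqrt_nonneg a).isSelfAdjoint.star_eq, CFC.sqrt_mul_sqrt_self a ha],
    fun _ hb => hb.cfcₙ_nnreal _⟩

theorem inner_self_eq_ofReal (f : Ell2 G) : ⟪f, f⟫_ℂ = ((‖f‖ ^ 2 : ℝ) : ℂ) := by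
  rw [inner_self_eq_norm_sq_to_K]
  simp

variable [Group G]

/-- The closure of `M δ_1`. -/
def cyclicSpace (M : VonNeumannAlgebra (Ell2 G)) : Submodule ℂ (Ell2 G) :=
  (M.toStarSubalgebra.toSubalgebra.toSubmodule.map
    (ContinuousLinearMap.apply ℂ (Ell2 G) (delta (1 : G))).toLinearMap).topologicalClosure

instance (M : VonNeumannAlgebra (Ell2 G)) : CompleteSpace (cyclicSpace M) :=
  (Submodule.isClosed_topologicalClosure _).completeSpace_coe

theorem cyclicSpace_induction {M : VonNeumannAlgebra (Ell2 G)} {p : Ell2 G → Prop}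
    (hp : IsClosed {f | p f}) (h : ∀ m ∈ M, p (m (delta 1))) {f : Ell2 G}
    (hf : f ∈ cyclicSpace M) : p f := by
  refine closure_minimal ?_ hp hf
  rintro _ ⟨m, hm, rfl⟩
  exact h m hm

theorem apply_mem_cyclicSpace {M : VonNeumannAlgebra (Ell2 G)} {m : Ell2 G →L[ℂ] Ell2 G}
    (hm : m ∈ M) : m (delta 1) ∈ cyclicSpace M :=
  Submodule.le_topologicalClosure _ ⟨m, hm, rfl⟩

theorem delta_one_mem_cyclicSpace (M : VonNeumannAlgebra (Ell2 G)) :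
    delta 1 ∈ cyclicSpace M :=
  apply_mem_cyclicSpace (one_mem M)

theorem map_mem_cyclicSpace {M : VonNeumannAlgebra (Ell2 G)} {m : Ell2 G →L[ℂ] Ell2 G}
    (hm : m ∈ M) {f : Ell2 G} (hf : f ∈ cyclicSpace M) : m f ∈ cyclicSpace M := by
  refine cyclicSpace_induction (p := fun f => m f ∈ cyclicSpace M)
    ((Submodule.isClosed_topologicalClosure _).preimage m.continuous) (fun n hn => ?_) hf
  exact apply_mem_cyclicSpace (m := m * n) (mul_mem hm hn)

/-- The orthogonal projection onto the closure of `M δ_1`. -/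
abbrev proj (M : VonNeumannAlgebra (Ell2 G)) : Ell2 G →L[ℂ] Ell2 G :=
  (cyclicSpace M).starProjection

theorem proj_mem (M : VonNeumannAlgebra (Ell2 G)) (f : Ell2 G) : proj M f ∈ cyclicSpace M :=
  Submodule.starProjection_apply_mem _ _

theorem proj_of_mem {M : VonNeumannAlgebra (Ell2 G)} {f : Ell2 G} (hf : f ∈ cyclicSpace M) :
    proj M f = f :=
  Submodule.starProjection_eq_self_iff.2 hf

theorem inner_proj {M : VonNeumannAlgebra (Ell2 G)} (f f' : Ell2 G) :
    ⟪proj M f, f'⟫_ℂ = ⟪f, proj M f'⟫_ℂ :=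
  Submodule.inner_starProjection_left_eq_right _ _ _

/-- An element of the closure of `M δ_1` is determined by its inner products with `M δ_1`. -/
theorem eq_of_inner_eq {M : VonNeumannAlgebra (Ell2 G)} {f f' : Ell2 G}
    (hf : f ∈ cyclicSpace M) (hf' : f' ∈ cyclicSpace M)
    (h : ∀ m ∈ M, ⟪m (delta 1), f⟫_ℂ = ⟪m (delta 1), f'⟫_ℂ) : f = f' := by
  have h0 : ⟪f - f', f - f'⟫_ℂ = 0 := by
    refine cyclicSpace_induction (p := fun v => ⟪v, f - f'⟫_ℂ = 0)
      (isClosed_eq (by fun_prop) continuous_const) (fun m hm => ?_) (sub_mem hf hf')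
    rw [inner_sub_right, h m hm, sub_self]
  exact sub_eq_zero.1 (inner_self_eq_zero.1 h0)

theorem proj_eq_iff {M : VonNeumannAlgebra (Ell2 G)} {f f' : Ell2 G} (hf' : f' ∈ cyclicSpace M) :
    proj M f = f' ↔ ∀ m ∈ M, ⟪m (delta 1), f⟫_ℂ = ⟪m (delta 1), f'⟫_ℂ := by
  have key : ∀ m ∈ M, ⟪m (delta 1), proj M f⟫_ℂ = ⟪m (delta 1), f⟫_ℂ := fun m hm => by
    rw [← inner_proj, proj_of_mem (apply_mem_cyclicSpace hm)]
  constructor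
  · rintro rfl m hm
    rw [key m hm]
  · intro h
    exact eq_of_inner_eq (proj_mem M f) hf' fun m hm => by rw [key m hm, h m hm]

/-- The closure of `M δ_1` is stable under `M` and `M` is closed under adjoints, so its projection
lies in the commutant of `M`. -/
theorem proj_apply_of_mem {M : VonNeumannAlgebra (Ell2 G)} {m : Ell2 G →L[ℂ] Ell2 G}
    (hm : m ∈ M) (f : Ell2 G) : proj M (m f) = m (proj M f) := by
  rw [proj_eq_iff (map_mem_cyclicSpace hm (proj_mem M f))]
  intro n hn
  have := (proj_eq_iff (proj_mem M f)).1 rfl (star m * n) (mul_mem (star_mem hm) hn)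
  simpa only [mul_apply_eq_comp, star_mul_inner (star m), star_star] using this

variable {M : VonNeumannAlgebra (Ell2 G)}

theorem commute_rightShift (hM : M ≤ groupVN G) {m : Ell2 G →L[ℂ] Ell2 G} (hm : m ∈ M) (g : G) :
    Commute m (rightShift g) :=
  commute_rightShift_of_mem (hM hm) g

theorem flip_mem_cyclicSpace (hM : M ≤ groupVN G) {f : Ell2 G} (hf : f ∈ cyclicSpace M) :
    flip f ∈ cyclicSpace M := by
  refine cyclicSpace_induction (p := fun f => flip f ∈ cyclicSpace M)
    ((Submodule.isClosed_topologicalClosure _).preimage continuous_flip) (fun m hm => ?_) hf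
  rw [← star_apply_delta_one (commute_rightShift hM hm)]
  exact apply_mem_cyclicSpace (star_mem hm)

theorem proj_flip (hM : M ≤ groupVN G) (f : Ell2 G) : proj M (flip f) = flip (proj M f) := by
  rw [proj_eq_iff (flip_mem_cyclicSpace hM (proj_mem M f))]
  intro m hm
  have h := star_apply_delta_one (commute_rightShift_star (commute_rightShift hM hm))
  rw [star_star] at h
  rw [h, inner_flip, inner_flip, ← inner_conj_symm, ← inner_conj_symm (proj M f),
    (proj_eq_iff (proj_mem M f)).1 rfl _ (star_mem hm)]

/-- An operator commuting with the right shifts belongs to `M ⊆ L(G)` as soon as it maps `δ_1`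
into the closure of `M δ_1`. -/
theorem mem_of_apply_mem_cyclicSpace (hM : M ≤ groupVN G) {y : Ell2 G →L[ℂ] Ell2 G}
    (hy : ∀ g, Commute y (rightShift g)) (h : y (delta 1) ∈ cyclicSpace M) : y ∈ M := by
  rw [← SetLike.mem_coe, ← VonNeumannAlgebra.centralizer_centralizer]
  intro T hT
  -- The matrix coefficients of `T z` and `z T` depend only on the vector `z δ_1`, continuously.
  -- Their equality for `z ∈ M` therefore passes to vectors in the closure, with no norm bound on
  -- the approximating operators.
  have left : ∀ {z : Ell2 G →L[ℂ] Ell2 G}, (∀ g, Commute z (rightShift g)) → ∀ h k : G,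
      ⟪delta h, (T * z) (delta k)⟫_ℂ =
        ⟪delta h, T (rightShift k⁻¹ (z (delta 1)))⟫_ℂ := fun hz h k => by
    rw [mul_apply_eq_comp, apply_delta hz]
  have right : ∀ {z : Ell2 G →L[ℂ] Ell2 G}, (∀ g, Commute z (rightShift g)) → ∀ h k : G,
      ⟪delta h, (z * T) (delta k)⟫_ℂ =
        ⟪rightShift h⁻¹ (flip (z (delta 1))), T (delta k)⟫_ℂ := fun {z} hz h k => by
    rw [mul_apply_eq_comp, ← star_apply_delta_one hz,
      ← apply_delta (commute_rightShift_star hz), star_mul_inner, star_star]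
  refine ext_delta fun k => ?_
  ext h'
  rw [← inner_delta_left, ← inner_delta_left, left hy, right hy]
  have c : Continuous fun f : Ell2 G => rightShift h'⁻¹ (flip f) :=
    (rightShift h'⁻¹).continuous.comp continuous_flip
  refine cyclicSpace_induction (p := fun v => ⟪delta h', T (rightShift k⁻¹ v)⟫_ℂ =
    ⟪rightShift h'⁻¹ (flip v), T (delta k)⟫_ℂ)
    (isClosed_eq (by fun_prop) (c.inner continuous_const)) (fun m hm => ?_) h
  rw [← left (commute_rightShift hM hm), ← right (commute_rightShift hM hm), ← hT m hm]

/-- The trace property of `L(G)` in terms of `ℓ²(G)`. -/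
theorem inner_apply_delta_one {x y : Ell2 G →L[ℂ] Ell2 G} (hx : ∀ g, Commute x (rightShift g))
    (hy : ∀ g, Commute y (rightShift g)) :
    ⟪x (delta 1), y (delta 1)⟫_ℂ = ⟪star y (delta 1), star x (delta 1)⟫_ℂ := by
  rw [star_apply_delta_one hx, star_apply_delta_one hy, inner_flip]

theorem proj_rightShift (hM : M ≤ groupVN G) {m : Ell2 G →L[ℂ] Ell2 G} (hm : m ∈ M) (g : G) :
    proj M (rightShift g (m (delta 1))) = m (proj M (delta g⁻¹)) := by
  rw [← proj_apply_of_mem hm, ← inv_inv g, ← apply_delta (commute_rightShift hM hm), inv_inv]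

/-- The compression of `x ∈ L(G)` to the closure of `M δ_1` commutes with the compressions of the
right shifts. -/
theorem commute_compression (hM : M ≤ groupVN G) {x : Ell2 G →L[ℂ] Ell2 G} (hx : x ∈ groupVN G)
    (g : G) : Commute (proj M * x * proj M) (proj M * rightShift g * proj M) := by
  have ee : ∀ f, proj M (proj M f) = proj M f := fun f => proj_of_mem (proj_mem M f)
  -- On `M δ_1`, `e r_g m δ_1 = m e δ_{g⁻¹}`. Moving `m` and `x` to the left and applying `J`, which
  -- commutes with `e` and sends `δ_{g⁻¹}` to `δ_g`, turns one side into the other.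
  have key : ∀ m ∈ M, ∀ n ∈ M, ⟪n (delta 1), x (proj M (rightShift g (m (delta 1))))⟫_ℂ =
      ⟪n (delta 1), rightShift g (proj M (x (m (delta 1))))⟫_ℂ := by
    intro m hm n hn
    have hz : ∀ g, Commute (star m * star x * n) (rightShift g) := fun g =>
      commute_rightShift_of_mem (mul_mem (mul_mem (star_mem (hM hm)) (star_mem hx)) (hM hn)) g
    calc ⟪n (delta 1), x (proj M (rightShift g (m (delta 1))))⟫_ℂ
        = ⟪(star m * star x * n) (delta 1), proj M (delta g⁻¹)⟫_ℂ := by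
          rw [proj_rightShift hM hm]
          simp only [mul_apply_eq_comp, star_mul_inner (star _), star_star]
      _ = ⟪flip (proj M (delta g⁻¹)), flip ((star m * star x * n) (delta 1))⟫_ℂ := by
          rw [inner_flip]
      _ = ⟪proj M (delta g), (star n * x * m) (delta 1)⟫_ℂ := by
          rw [← proj_flip hM, flip_delta, inv_inv, ← star_apply_delta_one hz]
          simp [mul_assoc]
      _ = ⟪n (delta 1), rightShift g (proj M (x (m (delta 1))))⟫_ℂ := by
          have := proj_rightShift hM hn g⁻¹
          rw [inv_inv] at this
          have h2 := inner_rightShift g⁻¹ (n (delta 1)) (proj M (x (m (delta 1))))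
          rw [inv_inv] at h2
          rw [← h2, ← inner_proj, this, star_mul_inner n]
          rfl
  have key' : ∀ f ∈ cyclicSpace M, ∀ f' ∈ cyclicSpace M, ⟪f', x (proj M (rightShift g f))⟫_ℂ =
      ⟪f', rightShift g (proj M (x f))⟫_ℂ := by
    intro f hf
    refine cyclicSpace_induction (p := fun f => ∀ f' ∈ cyclicSpace M,
      ⟪f', x (proj M (rightShift g f))⟫_ℂ = ⟪f', rightShift g (proj M (x f))⟫_ℂ) ?_
      (fun m hm f' hf' => ?_) hf
    · simp only [Set.ofPred_forall]
      exact isClosed_iInter fun f' => isClosed_iInter fun _ =>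
        isClosed_eq (by fun_prop) (by fun_prop)
    · exact cyclicSpace_induction (p := fun f' => ⟪f', x (proj M (rightShift g (m (delta 1))))⟫_ℂ =
        ⟪f', rightShift g (proj M (x (m (delta 1))))⟫_ℂ)
        (isClosed_eq (by fun_prop) (by fun_prop)) (fun n hn => key m hm n hn) hf'
  ext1 f
  simp only [mul_apply_eq_comp, ee]
  refine eq_of_inner_eq (proj_mem M _) (proj_mem M _) fun n hn => ?_
  rw [← inner_proj, ← inner_proj, proj_of_mem (apply_mem_cyclicSpace hn),
    key' _ (proj_mem M f) _ (apply_mem_cyclicSpace hn)]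

/-- The linear map sending the basis vector `g` to `r_g ξ`. -/
def rightConv (ξ : Ell2 G) : (G →₀ ℂ) →ₗ[ℂ] Ell2 G :=
  Finsupp.linearCombination ℂ fun g => rightShift g ξ

theorem rightConv_single (ξ : Ell2 G) (g : G) :
    rightConv ξ (Finsupp.single g 1) = rightShift g ξ := by
  simp [rightConv]

theorem inner_rightConv (ξ η : Ell2 G) (c : G →₀ ℂ) :
    ⟪rightConv ξ c, rightConv η c⟫_ℂ =
      ∑ g ∈ c.support, ∑ h ∈ c.support, star (c g) * c h * ⟪ξ, rightShift (g⁻¹ * h) η⟫_ℂ := by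
  simp only [rightConv, Finsupp.linearCombination_apply, Finsupp.sum, sum_inner, inner_sum,
    inner_smul_left, inner_smul_right, inner_rightShift, rightShift_mul, mul_apply_eq_comp,
    Finset.mul_sum]
  rw [Finset.sum_comm]
  refine Finset.sum_congr rfl fun g _ => ?_
  refine Finset.sum_congr rfl fun h _ => ?_
  rw [starRingEnd_apply]
  ring

theorem denseRange_rightConv : DenseRange (rightConv (delta (1 : G))) := by
  rw [DenseRange, dense_iff_closure_eq, ← LinearMap.coe_range, ← Submodule.topologicalClosure_coe,
    rightConv, Finsupp.range_linearCombination]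
  have : (Set.range fun g : G => rightShift g (delta 1)) = Set.range (delta (G := G)) := by
    rw [← (Equiv.inv G).surjective.range_comp delta]
    congr 1
    ext1 g
    simp [rightShift_delta]
  rw [this, span_delta, Submodule.top_coe]

/-- Both forms have kernels depending on `k = g⁻¹ h` only. Since `S` and `S*` commute with `e r_k e`
and `e δ_1 = δ_1`, one gets `⟪δ_1, r_k S* S δ_1⟫ = ⟪S δ_1, r_k S δ_1⟫`, so the form is a Gram form.
-/
theorem inner_rightConv_of_commute {T S : Ell2 G →L[ℂ] Ell2 G}
    (hS : ∀ g, Commute S (proj M * rightShift g * proj M)) (hT : T = star S * S)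
    (c : G →₀ ℂ) :
    ⟪rightConv (delta 1) c, rightConv (T (delta 1)) c⟫_ℂ =
      ⟪rightConv (S (delta 1)) c, rightConv (S (delta 1)) c⟫_ℂ := by
  have e1 : proj M (delta 1) = delta 1 := proj_of_mem (delta_one_mem_cyclicSpace M)
  -- The case `g = 1` of the commutation hypothesis: the compression of the identity is `e`.
  have hSe : ∀ f, proj M (S f) = S (proj M f) := by
    intro f
    have := congrArg (fun A => A f) (hS 1).eq
    simp only [rightShift_one, mul_one, mul_apply_eq_comp] at this
    rw [proj_of_mem (proj_mem M f), proj_of_mem (proj_mem M _)] at this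
    exact this.symm
  have hS' : ∀ g, Commute (star S) (proj M * rightShift g * proj M) := by
    intro g
    have := (hS g⁻¹).star_star
    simpa only [star_mul, star_rightShift, inv_inv, (isSelfAdjoint_starProjection _).star_eq,
      mul_assoc] using this
  rw [inner_rightConv, inner_rightConv]
  refine Finset.sum_congr rfl fun g _ => Finset.sum_congr rfl fun h _ => ?_
  congr 1
  have hc := congrArg (fun A => A (S (delta 1))) (hS' (g⁻¹ * h)).eq
  have he : proj M (star S (S (delta 1))) = star S (S (delta 1)) := by
    have := congrArg (fun A => A (S (delta 1))) (hS' 1).eq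
    simp only [rightShift_one, mul_one, mul_apply_eq_comp] at this
    rw [proj_of_mem (proj_mem M (S _)), proj_of_mem (proj_mem M (star S _)), hSe, e1] at this
    exact this.symm
  simp only [mul_apply_eq_comp, hSe, e1] at hc
  rw [he] at hc
  rw [hT, mul_apply_eq_comp]
  calc ⟪delta 1, rightShift (g⁻¹ * h) (star S (S (delta 1)))⟫_ℂ
      = ⟪delta 1, proj M (rightShift (g⁻¹ * h) (star S (S (delta 1))))⟫_ℂ := by
        rw [← inner_proj, e1]
    _ = ⟪S (delta 1), proj M (rightShift (g⁻¹ * h) (S (delta 1)))⟫_ℂ := by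
        rw [← hc, star_mul_inner]
    _ = _ := by rw [← inner_proj, hSe, e1]

theorem inner_rightConv_nonneg {T : Ell2 G →L[ℂ] Ell2 G} (h0 : 0 ≤ T)
    (hT : ∀ g, Commute T (proj M * rightShift g * proj M)) (c : G →₀ ℂ) :
    0 ≤ ⟪rightConv (delta 1) c, rightConv (T (delta 1)) c⟫_ℂ := by
  obtain ⟨S, hS, hc⟩ := exists_star_mul_self h0
  rw [inner_rightConv_of_commute (S := S) (M := M) (fun g => hc _ (hT g)) hS.symm,
    inner_self_eq_ofReal]
  exact Complex.zero_le_real.2 (sq_nonneg _)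

/-- The square of the left side is the form attached to `T* T`. Positivity of the form attached to
`‖T‖² - T* T` bounds it. -/
theorem norm_rightConv_le {T : Ell2 G →L[ℂ] Ell2 G}
    (hT : ∀ g, Commute T (proj M * rightShift g * proj M)) (c : G →₀ ℂ) :
    ‖rightConv (T (delta 1)) c‖ ≤ ‖T‖ * ‖rightConv (delta 1) c‖ := by
  have hT' : ∀ g, Commute (star T) (proj M * rightShift g * proj M) := by
    intro g
    have := (hT g⁻¹).star_star
    simpa only [star_mul, star_rightShift, inv_inv, (isSelfAdjoint_starProjection _).star_eq,
      mul_assoc] using this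
  have hle : star T * T ≤ algebraMap ℝ (Ell2 G →L[ℂ] Ell2 G) (‖T‖ ^ 2) :=
    CStarAlgebra.star_mul_le_algebraMap_norm_sq
  have h := inner_rightConv_nonneg (M := M) (sub_nonneg.2 hle)
    (fun g => (Algebra.commute_algebraMap_left _ _).sub_left ((hT' g).mul_left (hT g))) c
  have hsub : rightConv ((algebraMap ℝ (Ell2 G →L[ℂ] Ell2 G) (‖T‖ ^ 2) - star T * T) (delta 1)) c
      = ((‖T‖ ^ 2 : ℝ) : ℂ) • rightConv (delta 1) c - rightConv ((star T * T) (delta 1)) c := by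
    simp only [rightConv, Finsupp.linearCombination_apply, Finsupp.sum, Finset.smul_sum,
      ← Finset.sum_sub_distrib]
    refine Finset.sum_congr rfl fun g _ => ?_
    rw [sub_apply, Algebra.algebraMap_eq_smul_one, map_sub, smul_sub]
    congr 1
    rw [smul_comm]
    congr 1
  rw [hsub, inner_sub_right, inner_smul_right, inner_rightConv_of_commute hT rfl,
    inner_self_eq_ofReal, inner_self_eq_ofReal, ← Complex.ofReal_mul, ← Complex.ofReal_sub,
    Complex.zero_le_real] at h
  exact le_of_sq_le_sq (by rw [mul_pow]; linarith) (by positivity)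

/-- Existence of the conditional expectation, on a single element. -/
theorem exists_mem_apply_delta_one (hM : M ≤ groupVN G) {x : Ell2 G →L[ℂ] Ell2 G}
    (hx : x ∈ groupVN G) :
    ∃ y ∈ M, y (delta 1) = proj M (x (delta 1)) ∧
      ∀ c, y (rightConv (delta 1) c) = rightConv ((proj M * x * proj M) (delta 1)) c := by
  set T := proj M * x * proj M with hTdef
  have hT := commute_compression hM hx
  have hT1 : T (delta 1) = proj M (x (delta 1)) := by
    simp only [hTdef, mul_apply_eq_comp, proj_of_mem (delta_one_mem_cyclicSpace M)]
  -- The norm bound makes `r_g δ_1 ↦ r_g T δ_1` extend continuously from finitely supported vectors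
  -- to `ℓ²(G)`.
  set y := (rightConv (T (delta 1))).extendOfNorm (rightConv (delta (1 : G))) with hydef
  have hy : ∀ c, y (rightConv (delta 1) c) = rightConv (T (delta 1)) c :=
    LinearMap.extendOfNorm_eq denseRange_rightConv ⟨‖T‖, norm_rightConv_le hT⟩
  have hy1 : ∀ g, y (delta g) = rightShift g⁻¹ (T (delta 1)) := fun g => by
    have := hy (Finsupp.single g⁻¹ 1)
    rwa [rightConv_single, rightConv_single, rightShift_delta, one_mul, inv_inv] at this
  have h1 : y (delta 1) = T (delta 1) := by simp [hy1, rightShift_one]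
  refine ⟨y, mem_of_apply_mem_cyclicSpace hM (fun g => ext_delta fun h => ?_) ?_, h1.trans hT1, hy⟩
  · simp only [mul_apply_eq_comp, rightShift_delta, hy1, mul_inv_rev, inv_inv, rightShift_mul]
  · rw [h1, hT1]
    exact proj_mem M _

/-- The value at `x` of the conditional expectation of `L(G)` onto `M`. -/
def condExpFun (hM : M ≤ groupVN G) (x : (groupVN G).toStarSubalgebra) : M.toStarSubalgebra :=
  ⟨(exists_mem_apply_delta_one hM x.2).choose, (exists_mem_apply_delta_one hM x.2).choose_spec.1⟩

theorem condExpFun_delta_one (hM : M ≤ groupVN G) (x : (groupVN G).toStarSubalgebra) :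
    (condExpFun hM x : Ell2 G →L[ℂ] Ell2 G) (delta 1) =
      proj M ((x : Ell2 G →L[ℂ] Ell2 G) (delta 1)) :=
  (exists_mem_apply_delta_one hM x.2).choose_spec.2.1

theorem condExpFun_rightConv (hM : M ≤ groupVN G) (x : (groupVN G).toStarSubalgebra) (c : G →₀ ℂ) :
    (condExpFun hM x : Ell2 G →L[ℂ] Ell2 G) (rightConv (delta 1) c) =
      rightConv ((proj M * x * proj M) (delta 1)) c :=
  (exists_mem_apply_delta_one hM x.2).choose_spec.2.2 c

theorem subtype_ext_delta_one (hM : M ≤ groupVN G) {a b : M.toStarSubalgebra}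
    (h : (a : Ell2 G →L[ℂ] Ell2 G) (delta 1) = (b : Ell2 G →L[ℂ] Ell2 G) (delta 1)) : a = b :=
  Subtype.ext (ext_delta_one (commute_rightShift hM a.2) (commute_rightShift hM b.2) h)

/-- The conditional expectation of `L(G)` onto a von Neumann subalgebra. -/
def condExp (hM : M ≤ groupVN G) : (groupVN G).toStarSubalgebra →ₗ[ℂ] M.toStarSubalgebra where
  toFun := condExpFun hM
  map_add' x y := subtype_ext_delta_one hM <| by
    simp [condExpFun_delta_one]
  map_smul' c x := subtype_ext_delta_one hM <| by
    simp [condExpFun_delta_one]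

theorem condExp_delta_one (hM : M ≤ groupVN G) (x : (groupVN G).toStarSubalgebra) :
    (condExp hM x : Ell2 G →L[ℂ] Ell2 G) (delta 1) =
      proj M ((x : Ell2 G →L[ℂ] Ell2 G) (delta 1)) :=
  condExpFun_delta_one hM x

/-- This is right `M`-linearity: the trace property moves `b` across the inner product as `b*`,
reducing to the defining equation at `δ_1`. -/
theorem condExp_apply_delta_one_of_mem (hM : M ≤ groupVN G) (x : (groupVN G).toStarSubalgebra)
    {b : Ell2 G →L[ℂ] Ell2 G} (hb : b ∈ M) :
    (condExp hM x : Ell2 G →L[ℂ] Ell2 G) (b (delta 1)) =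
      proj M ((x : Ell2 G →L[ℂ] Ell2 G) (b (delta 1))) := by
  symm
  rw [proj_eq_iff (map_mem_cyclicSpace (condExp hM x).2 (apply_mem_cyclicSpace hb))]
  have key : ∀ z ∈ groupVN G, ∀ m ∈ M, ⟪m (delta 1), z (b (delta 1))⟫_ℂ =
      ⟪(m * star b) (delta 1), z (delta 1)⟫_ℂ := by
    intro z hz m hm
    rw [show z (b (delta 1)) = (z * b) (delta 1) from rfl, inner_apply_delta_one
      (commute_rightShift hM hm) (commute_rightShift_of_mem (mul_mem hz (hM hb))),
      inner_apply_delta_one (commute_rightShift hM (mul_mem hm (star_mem hb)))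
        (commute_rightShift_of_mem hz), star_mul, star_mul, star_star, mul_apply_eq_comp,
      mul_apply_eq_comp, star_mul_inner, star_star]
  intro m hm
  rw [key _ x.2 m hm, key _ (hM (condExp hM x).2) m hm, condExp_delta_one]
  exact (proj_eq_iff (proj_mem M _)).1 rfl _ (mul_mem hm (star_mem hb))

theorem nonneg_of_inner_rightConv {y : Ell2 G →L[ℂ] Ell2 G}
    (h : ∀ c, 0 ≤ ⟪rightConv (delta 1) c, y (rightConv (delta 1) c)⟫_ℂ) : 0 ≤ y := by
  rw [ContinuousLinearMap.nonneg_iff_isPositive, ContinuousLinearMap.isPositive_iff_complex]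
  intro f
  have hf : 0 ≤ ⟪f, y f⟫_ℂ :=
    (denseRange_rightConv (G := G)).induction_on (p := fun f => 0 ≤ ⟪f, y f⟫_ℂ) f
      (isClosed_le continuous_const (by fun_prop)) h
  have h2 := Complex.le_def.1 hf
  rw [← inner_conj_symm]
  refine ⟨Complex.ext ?_ ?_, ?_⟩
  · simp only [RCLike.re_to_complex, Complex.ofReal_re]
  · rw [Complex.conj_im, ← h2.2]
    simp
  · rw [RCLike.re_to_complex, Complex.conj_re]
    exact h2.1

theorem isCondExp_condExp (hM : M ≤ groupVN G) : IsCondExp M (condExp hM) where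
  le := hM
  apply_of_mem x hx := by
    refine ext_delta_one (commute_rightShift hM (condExp hM x).2)
      (commute_rightShift_of_mem x.2) ?_
    rw [condExp_delta_one, proj_of_mem (apply_mem_cyclicSpace hx)]
  bimodule a b x y h := by
    refine subtype_ext_delta_one hM ?_
    rw [condExp_delta_one, h]
    change _ = (a : Ell2 G →L[ℂ] Ell2 G) ((condExp hM x : Ell2 G →L[ℂ] Ell2 G)
      ((b : Ell2 G →L[ℂ] Ell2 G) (delta 1)))
    rw [condExp_apply_delta_one_of_mem hM x b.2, ← proj_apply_of_mem a.2]
    rfl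
  nonneg x hx := by
    refine nonneg_of_inner_rightConv fun c => ?_
    change 0 ≤ ⟪_, (condExpFun hM x : Ell2 G →L[ℂ] Ell2 G) _⟫_ℂ
    rw [condExpFun_rightConv]
    refine inner_rightConv_nonneg ?_ (commute_compression hM x.2) c
    have := star_left_conjugate_nonneg hx (proj M)
    rwa [(isSelfAdjoint_starProjection _).star_eq] at this
  trace_apply x := by
    rw [trace, condExp_delta_one, ← inner_proj, proj_of_mem (delta_one_mem_cyclicSpace M), trace]

/-- For `m ∈ M`, `τ(m* E(x)) = τ(E(m* x)) = τ(m* x)`, so `E(x) δ_1` and `x δ_1` have the same inner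
products with `M δ_1`. -/
theorem IsCondExp.apply_delta_one {E : (groupVN G).toStarSubalgebra →ₗ[ℂ] M.toStarSubalgebra}
    (hE : IsCondExp M E) (x : (groupVN G).toStarSubalgebra) :
    (E x : Ell2 G →L[ℂ] Ell2 G) (delta 1) = proj M ((x : Ell2 G →L[ℂ] Ell2 G) (delta 1)) := by
  symm
  rw [proj_eq_iff (apply_mem_cyclicSpace (E x).2)]
  intro m hm
  let a : M.toStarSubalgebra := ⟨star m, star_mem hm⟩
  let y : (groupVN G).toStarSubalgebra := ⟨star m * x, mul_mem (star_mem (hE.le hm)) x.2⟩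
  have h1 : E y = a * E x * 1 := hE.bimodule a 1 x y (by simp [y, a])
  have h2 := hE.trace_apply y
  rw [h1, mul_one] at h2
  rw [star_mul_inner, star_mul_inner]
  exact h2.symm

/-- Every von Neumann subalgebra of `L(G)` admits a unique trace-preserving conditional
expectation. -/
theorem existsUnique_isCondExp (hM : M ≤ groupVN G) :
    ∃! E : (groupVN G).toStarSubalgebra →ₗ[ℂ] M.toStarSubalgebra, IsCondExp M E :=
  ⟨condExp hM, isCondExp_condExp hM, fun E hE => LinearMap.ext fun x =>
    subtype_ext_delta_one hM (by rw [hE.apply_delta_one, condExp_delta_one])⟩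

end ConditionalExpectation

/-! ### Invariant subspaces, supports and conjugation for generated algebras -/

section Generated

/-- Stability under `S` and `S*` puts the projection onto `K` in the commutant, so it commutes with
the bicommutant. -/
theorem generated_map_mem {H : Type*} [NormedAddCommGroup H] [InnerProductSpace ℂ H]
    [CompleteSpace H] {S : Set (H →L[ℂ] H)} (K : Submodule ℂ H) [K.HasOrthogonalProjection]
    (hS : ∀ s ∈ S, ∀ f ∈ K, s f ∈ K) (hS' : ∀ s ∈ S, ∀ f ∈ K, star s f ∈ K)
    {m : H →L[ℂ] H} (hm : m ∈ generated S) {f : H} (hf : f ∈ K) : m f ∈ K := by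
  have hP : star K.starProjection = K.starProjection := (isSelfAdjoint_starProjection K).star_eq
  have key : ∀ a : H →L[ℂ] H, (∀ f ∈ K, a f ∈ K) → (∀ f ∈ K, star a f ∈ K) →
      Commute a K.starProjection := by
    have aux : ∀ a : H →L[ℂ] H, (∀ f ∈ K, a f ∈ K) →
        K.starProjection * a * K.starProjection = a * K.starProjection := fun a ha => by
      ext1 f
      exact Submodule.starProjection_eq_self_iff.2 (ha _ (Submodule.starProjection_apply_mem _ _))
    intro a ha ha'
    have h := congrArg star (aux _ ha')
    rw [star_mul, star_mul, star_mul, star_star, hP, ← mul_assoc, aux a ha] at h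
    exact h
  have hc := mem_generated_iff.1 hm K.starProjection fun s hs =>
    ⟨key s (hS s hs) (hS' s hs), key _ (hS' s hs) (by simpa using hS s hs)⟩
  rw [← Submodule.starProjection_eq_self_iff.2 hf, ← mul_apply_eq_comp, ← hc.eq]
  exact Submodule.starProjection_apply_mem _ _

variable {G : Type*}

theorem ell2_add_apply (f f' : Ell2 G) (g : G) : (f + f') g = f g + f' g := rfl

theorem ell2_smul_apply (c : ℂ) (f : Ell2 G) (g : G) : (c • f) g = c * f g := rfl

/-- The vectors of `ℓ²(G)` supported in `X`. -/
def supportedOn (X : Set G) : Submodule ℂ (Ell2 G) where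
  carrier := {f | ∀ g ∉ X, f g = 0}
  zero_mem' _ _ := rfl
  add_mem' {f f'} hf hf' g hg := by
    rw [ell2_add_apply, hf g hg, hf' g hg, add_zero]
  smul_mem' c f hf g hg := by
    rw [ell2_smul_apply, hf g hg, mul_zero]

theorem mem_supportedOn {X : Set G} {f : Ell2 G} : f ∈ supportedOn X ↔ ∀ g ∉ X, f g = 0 := Iff.rfl

theorem delta_mem_supportedOn {X : Set G} {g : G} (hg : g ∈ X) : delta g ∈ supportedOn X := by
  classical
  intro h hh
  rw [delta_apply, if_neg]
  rintro rfl
  exact hh hg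

instance (X : Set G) : CompleteSpace (supportedOn X) := by
  have : ((supportedOn X : Submodule ℂ (Ell2 G)) : Set (Ell2 G)) =
      ⋂ g, ⋂ _ : g ∉ X, {f | ⟪delta g, f⟫_ℂ = 0} := by
    ext f
    simp [mem_supportedOn, inner_delta_left]
  have hc : IsClosed ((supportedOn X : Submodule ℂ (Ell2 G)) : Set (Ell2 G)) := by
    rw [this]
    exact isClosed_iInter fun g => isClosed_iInter fun _ =>
      isClosed_eq (by fun_prop) continuous_const
  exact hc.completeSpace_coe

theorem inner_eq_zero_of_disjoint {X Y : Set G} (h : Disjoint X Y) {f f' : Ell2 G}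
    (hf : f ∈ supportedOn X) (hf' : f' ∈ supportedOn Y) : ⟪f, f'⟫_ℂ = 0 := by
  rw [lp.inner_eq_tsum]
  convert tsum_zero with g
  by_cases hg : g ∈ X
  · rw [hf' g (Set.disjoint_left.1 h hg), inner_zero_right]
  · rw [hf g hg, inner_zero_left]

variable [Group G]

theorem regRep_mem_supportedOn {X : Set G} {g : G}
    (hX : ∀ h ∈ X, g * h ∈ X) {f : Ell2 G} (hf : f ∈ supportedOn X) :
    regRep G g f ∈ supportedOn X := by
  intro h hh
  rw [regRep_apply]
  refine hf _ fun h' => hh ?_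
  simpa using hX _ h'

theorem apply_delta_one_mem_supportedOn {N : Subgroup G} {x : Ell2 G →L[ℂ] Ell2 G}
    (hx : x ∈ subgroupVN N) : x (delta 1) ∈ supportedOn (N : Set G) := by
  refine generated_map_mem _ ?_ ?_ hx (delta_mem_supportedOn N.one_mem)
  · rintro _ ⟨g, hg, rfl⟩ f hf
    exact regRep_mem_supportedOn (fun h hh => N.mul_mem hg hh) hf
  · rintro _ ⟨g, hg, rfl⟩ f hf
    rw [star_regRep]
    exact regRep_mem_supportedOn (fun h hh => N.mul_mem (N.inv_mem hg) hh) hf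

theorem regRep_mul_star (g : G) : regRep G g * star (regRep G g) = 1 := by
  rw [star_regRep, ← map_mul, mul_inv_cancel, map_one]

theorem star_mul_regRep (g : G) : star (regRep G g) * regRep G g = 1 := by
  rw [star_regRep, ← map_mul, inv_mul_cancel, map_one]

theorem conj_mem_generated {S : Set (Ell2 G →L[ℂ] Ell2 G)} {g : G}
    (hS : ∀ s ∈ S, regRep G g * s * star (regRep G g) ∈ generated S)
    {m : Ell2 G →L[ℂ] Ell2 G} (hm : m ∈ generated S) :
    regRep G g * m * star (regRep G g) ∈ generated S := by
  set u := regRep G g with hu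
  have h1 : u * star u = 1 := regRep_mul_star g
  have h2 : star u * u = 1 := star_mul_regRep g
  -- Conjugation by `u` can be shifted to the other operator, which transports commutation tests
  -- between `S` and its conjugate.
  have tr : ∀ a y : Ell2 G →L[ℂ] Ell2 G, Commute (u * a * star u) y ↔
      Commute a (star u * y * u) := by
    intro a y
    constructor
    · intro h
      have := congrArg (fun b => star u * b * u) h.eq
      calc a * (star u * y * u) = (star u * u) * a * (star u * y * u) := by rw [h2, one_mul]
        _ = star u * (u * a * star u * y) * u := by simp only [mul_assoc]
        _ = star u * y * u * a * (star u * u) := by rw [h.eq]; simp only [mul_assoc]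
        _ = _ := by rw [h2, mul_one]
    · intro h
      calc u * a * star u * y = u * a * star u * y * (u * star u) := by rw [h1, mul_one]
        _ = u * (a * (star u * y * u)) * star u := by simp only [mul_assoc]
        _ = (u * star u) * y * (u * a * star u) := by rw [h.eq]; simp only [mul_assoc]
        _ = _ := by rw [h1, one_mul]
  rw [mem_generated_iff]
  intro y hy
  have hy' : ∀ x ∈ generated S, Commute x y := fun x hx => (mem_generated_iff.1 hx y hy).symm
  refine ((tr m y).2 (mem_generated_iff.1 hm _ fun s hs => ?_).symm).symm
  refine ⟨(tr s y).1 (hy' _ (hS s hs)), (tr (star s) y).1 (hy' _ ?_)⟩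
  have := star_mem (hS s hs)
  rwa [star_mul, star_mul, star_star, ← mul_assoc] at this

end Generated

/-! ### The projections `Q^A` and the action of permutations -/

section Wreath

/-- The coefficients of a nontrivial projection of `L(ℤ₂)`. -/
theorem coeff_of_isStarProjection {Q : Ell2 Z2 →L[ℂ] Ell2 Z2} (hQmem : Q ∈ groupVN Z2)
    (hQ : IsStarProjection Q) (hQ0 : Q ≠ 0) (hQ1 : Q ≠ 1) :
    coeff Q 1 = 1 / 2 ∧ coeff Q (Multiplicative.ofAdd 1) ^ 2 = 1 / 4 ∧
      star (coeff Q (Multiplicative.ofAdd 1)) = coeff Q (Multiplicative.ofAdd 1) := by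
  have hc := commute_rightShift_of_mem hQmem
  set a : Z2 := Multiplicative.ofAdd 1 with ha
  have ha1 : a ≠ 1 := by decide
  have haa : a⁻¹ = a := by decide
  have haa' : a * a = 1 := by decide
  have hcases : ∀ g : Z2, g = 1 ∨ g = a := by decide
  have hvec : Q (delta 1) = coeff Q 1 • delta 1 + coeff Q a • delta a := by
    ext g
    rcases hcases g with rfl | rfl <;>
      simp [ell2_add_apply, ell2_smul_apply, delta_apply, coeff, ha1, ha1.symm]
  have hstar : star (coeff Q a) = coeff Q a := by
    have := star_apply_delta_one hc
    rw [hQ.isSelfAdjoint.star_eq] at this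
    have := congrArg (fun f : Ell2 Z2 => f a) this
    simp only [flip_apply, haa] at this
    exact this.symm
  have hsq : Q (Q (delta 1)) = Q (delta 1) := by
    rw [← mul_apply_eq_comp, hQ.isIdempotentElem.eq]
  have hexp : coeff Q 1 • Q (delta 1) + coeff Q a • rightShift a (Q (delta 1)) = Q (delta 1) := by
    rw [hvec, map_add, map_smul, map_smul, apply_delta hc a, haa] at hsq
    rw [← hvec] at hsq
    exact hsq
  have e1 := congrArg (fun f : Ell2 Z2 => f 1) hexp
  have e2 := congrArg (fun f : Ell2 Z2 => f a) hexp
  simp only [ell2_add_apply, ell2_smul_apply, rightShift_apply, one_mul, haa'] at e1 e2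
  change coeff Q 1 * coeff Q 1 + coeff Q a * coeff Q a = coeff Q 1 at e1
  change coeff Q 1 * coeff Q a + coeff Q a * coeff Q 1 = coeff Q a at e2
  -- A vanishing coefficient would leave an idempotent scalar, that is `0` or `1`.
  have hne : coeff Q a ≠ 0 := by
    intro h0
    rw [h0, mul_zero, add_zero] at e1
    rw [h0, zero_smul, add_zero] at hvec
    rcases ((mul_left_eq_self₀.1 e1).symm : coeff Q 1 = 0 ∨ coeff Q 1 = 1) with h | h
    · refine hQ0 (ext_delta_one hc (fun g => Commute.zero_left _) ?_)
      rw [hvec, h, zero_smul]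
      rfl
    · refine hQ1 (ext_delta_one hc (fun g => Commute.one_left _) ?_)
      rw [hvec, h, one_smul]
      rfl
  have h0 : coeff Q 1 = 1 / 2 := by
    have : coeff Q a * (2 * coeff Q 1 - 1) = 0 := by linear_combination e2
    rcases mul_eq_zero.1 this with h | h
    · exact absurd h hne
    · linear_combination h / 2
  refine ⟨h0, ?_, hstar⟩
  rw [h0] at e1
  linear_combination e1

theorem copy_eq (Q : Ell2 Z2 →L[ℂ] Ell2 Z2) (n : ℕ+) :
    copy Q n = coeff Q 1 • 1 +
      coeff Q (Multiplicative.ofAdd 1) •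
        regRep WreathInf (ofSum (coord n (Multiplicative.ofAdd 1))) := by
  have h := Fin.sum_univ_two (fun z : Fin 2 =>
    coeff Q (Multiplicative.ofAdd (show ZMod 2 from z)) •
      regRep WreathInf (ofSum (coord n (Multiplicative.ofAdd (show ZMod 2 from z)))))
  have h1 : regRep WreathInf (ofSum (coord n 1)) = 1 := by simp
  rw [← h1]
  exact h

theorem coord_mul_self (n : ℕ+) (z : Z2) : coord n z * coord n z = 1 := by
  rw [← map_mul, show z * z = 1 from by revert z; decide, map_one]

theorem copy_mul_self {Q : Ell2 Z2 →L[ℂ] Ell2 Z2} (h0 : coeff Q 1 = 1 / 2)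
    (h1 : coeff Q (Multiplicative.ofAdd 1) ^ 2 = 1 / 4) (n : ℕ+) :
    copy Q n * copy Q n = copy Q n := by
  rw [copy_eq, h0]
  set c := coeff Q (Multiplicative.ofAdd 1)
  set w := regRep WreathInf (ofSum (coord n (Multiplicative.ofAdd 1))) with hw
  have hww : w * w = 1 := by
    rw [hw, ← map_mul, ← map_mul, coord_mul_self, map_one, map_one]
  simp only [add_mul, mul_add, smul_mul_assoc, mul_smul_comm, one_mul, mul_one, hww]
  have hcc : c * c = 1 / 4 := by rw [← sq, h1]
  calc _ = (1 / 4 + c * c) • (1 : Ell2 WreathInf →L[ℂ] Ell2 WreathInf) + c • w := by module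
    _ = _ := by rw [hcc]; module

theorem star_copy {Q : Ell2 Z2 →L[ℂ] Ell2 Z2} (h0 : coeff Q 1 = 1 / 2)
    (h1 : star (coeff Q (Multiplicative.ofAdd 1)) = coeff Q (Multiplicative.ofAdd 1)) (n : ℕ+) :
    star (copy Q n) = copy Q n := by
  rw [copy_eq, h0, star_add, star_smul, star_smul, h1, star_one, star_regRep, ← map_inv ofSum]
  have : (coord n (Multiplicative.ofAdd (1 : ZMod 2)))⁻¹ = coord n (Multiplicative.ofAdd 1) :=
    inv_eq_of_mul_eq_one_left (coord_mul_self n _)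
  rw [this]
  simp

theorem permAction_coord (s : SInf) (n : ℕ+) (z : Z2) :
    permAction s (coord n z) = coord (s.1 n) z := by
  change Multiplicative.ofAdd (Finsupp.domCongr (M := ZMod 2) s.1 (Finsupp.single n z.toAdd)) = _
  rw [Finsupp.domCongr_apply, Finsupp.equivMapDomain_single]
  rfl

theorem ofPerm_mul_ofSum (s : SInf) (z : Z2Inf) :
    ofPerm s * ofSum z = ofSum (permAction s z) * ofPerm s := by
  rw [SemidirectProduct.inl_aut, map_inv, inv_mul_cancel_right]

theorem regRep_ofPerm_mul_ofSum (s : SInf) (z : Z2Inf) :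
    regRep WreathInf (ofPerm s) * regRep WreathInf (ofSum z) =
      regRep WreathInf (ofSum (permAction s z)) * regRep WreathInf (ofPerm s) := by
  rw [← map_mul, ← map_mul, ofPerm_mul_ofSum]

variable {Q : Ell2 Z2 →L[ℂ] Ell2 Z2}

theorem regRep_ofPerm_mul_copy (s : SInf) (n : ℕ+) :
    regRep WreathInf (ofPerm s) * copy Q n = copy Q (s.1 n) * regRep WreathInf (ofPerm s) := by
  rw [copy, copy, Finset.mul_sum, Finset.sum_mul]
  refine Finset.sum_congr rfl fun z _ => ?_
  rw [mul_smul_comm, smul_mul_assoc, regRep_ofPerm_mul_ofSum, permAction_coord]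

theorem commute_ofSum_copy (z : Z2Inf) (n : ℕ+) :
    Commute (regRep WreathInf (ofSum z)) (copy Q n) :=
  Commute.sum_right _ _ _ fun w _ =>
    (((Commute.all z (coord n w)).map ofSum).map (regRep WreathInf)).smul_right _

theorem power_empty : power Q ∅ = 1 := Finset.noncommProd_empty _ _

theorem power_insert_of_notMem {n : ℕ+} {A : Finset ℕ+} (h : n ∉ A) :
    power Q (insert n A) = copy Q n * power Q A :=
  Finset.noncommProd_insert_of_notMem _ _ _ _ h

theorem commute_power {x : Ell2 WreathInf →L[ℂ] Ell2 WreathInf} (hx : ∀ n, Commute x (copy Q n))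
    (A : Finset ℕ+) : Commute x (power Q A) :=
  Finset.noncommProd_commute _ _ _ _ fun n _ => hx n

theorem regRep_ofPerm_mul_power (s : SInf) (A : Finset ℕ+) :
    regRep WreathInf (ofPerm s) * power Q A =
      power Q (A.map s.1.toEmbedding) * regRep WreathInf (ofPerm s) := by
  induction A using Finset.induction_on with
  | empty => rw [Finset.map_empty, power_empty, mul_one, one_mul]
  | insert n A hn ih =>
    rw [Finset.map_insert, power_insert_of_notMem hn, power_insert_of_notMem (by simpa using hn),
      ← mul_assoc, regRep_ofPerm_mul_copy, mul_assoc, ih, mul_assoc]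
    rfl

theorem copy_mul_power (hQ : ∀ n, copy Q n * copy Q n = copy Q n) (n : ℕ+) (A : Finset ℕ+) :
    copy Q n * power Q A = power Q (insert n A) := by
  by_cases h : n ∈ A
  · rw [Finset.insert_eq_of_mem h, ← Finset.insert_erase h,
      power_insert_of_notMem (Finset.notMem_erase n A), ← mul_assoc, hQ]
  · rw [power_insert_of_notMem h]

theorem power_mul_power (hQ : ∀ n, copy Q n * copy Q n = copy Q n) (A B : Finset ℕ+) :
    power Q A * power Q B = power Q (A ∪ B) := by
  induction A using Finset.induction_on with
  | empty => rw [power_empty, one_mul, Finset.empty_union]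
  | insert n A hn ih =>
    rw [power_insert_of_notMem hn, mul_assoc, ih, copy_mul_power hQ, Finset.insert_union]

theorem star_power (hQ : ∀ n, star (copy Q n) = copy Q n) (A : Finset ℕ+) :
    star (power Q A) = power Q A := by
  induction A using Finset.induction_on with
  | empty => rw [power_empty, star_one]
  | insert n A hn ih =>
    rw [power_insert_of_notMem hn, star_mul, ih, hQ,
      (commute_power (fun m => copy_commute Q n m) A).eq]

/-! ### Supports of permutations and relations between the generators -/

theorem mem_supp {s : SInf} {n : ℕ+} : n ∈ supp s ↔ s.1 n ≠ n := by
  exact Set.Finite.mem_toFinset _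

theorem map_supp_conj (s t : SInf) : (supp s).map t.1.toEmbedding = supp (t * s * t⁻¹) := by
  ext n
  simp only [Finset.mem_map_equiv, mem_supp, Subgroup.coe_mul, InvMemClass.coe_inv,
    Equiv.Perm.mul_apply, Equiv.Perm.inv_def]
  rw [not_iff_not, ← Equiv.eq_symm_apply t.1]

theorem map_supp (s : SInf) : (supp s).map s.1.toEmbedding = supp s := by
  rw [map_supp_conj, mul_inv_cancel_right]

theorem supp_inv (s : SInf) : supp s⁻¹ = supp s := by
  ext n
  simp only [mem_supp, InvMemClass.coe_inv, not_iff_not, ne_eq]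
  rw [Equiv.Perm.inv_eq_iff_eq, eq_comm]

/-- Off `supp s` the permutation `s` is the identity, so being moved by `t`, by `s t`, or lying in
`s (supp t)` are equivalent there. -/
theorem supp_union_map (s t : SInf) : supp s ∪ (supp t).map s.1.toEmbedding =
    (supp s ∪ supp t) ∪ supp (s * t) := by
  ext n
  simp only [Finset.mem_union, Finset.mem_map_equiv, mem_supp, Subgroup.coe_mul,
    Equiv.Perm.mul_apply]
  by_cases h : s.1 n = n
  · have h' : s.1.symm n = n := by rw [Equiv.symm_apply_eq, h]
    simp only [h, h', ne_eq, not_true_eq_false, false_or]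
    refine ⟨Or.inl, ?_⟩
    rintro (h2 | h2) h3
    · exact h2 h3
    · rw [h3] at h2
      exact h2 h
  · simp [h]

theorem supp_transposition {i j : ℕ+} (h : i ≠ j) : supp (transposition i j) = {i, j} := by
  ext n
  rw [mem_supp, transposition, Finset.mem_insert, Finset.mem_singleton]
  change Equiv.swap i j n ≠ n ↔ _
  rw [Equiv.swap_apply_ne_self_iff]
  simp [h]

/-- The generator `s Q^{supp s}` of `M_Q`. -/
def gen (Q : Ell2 Z2 →L[ℂ] Ell2 Z2) (s : SInf) : Ell2 WreathInf →L[ℂ] Ell2 WreathInf :=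
  regRep WreathInf (ofPerm s) * power Q (supp s)

theorem gen_eq (s : SInf) : gen Q s = power Q (supp s) * regRep WreathInf (ofPerm s) := by
  rw [gen, regRep_ofPerm_mul_power, map_supp]

/-- Moving `s` past `Q^(supp t)` gives `Q^(supp s ∪ s (supp t))`. That index set contains `supp (s
t)`, so by idempotence the generator of `s t` can be split off. -/
theorem gen_mul_gen (hQ : ∀ n, copy Q n * copy Q n = copy Q n) (s t : SInf) :
    gen Q s * gen Q t = power Q (supp s ∪ supp t) * gen Q (s * t) := by
  rw [gen_eq, gen_eq, gen_eq, mul_assoc, ← mul_assoc _ (power Q (supp t)), regRep_ofPerm_mul_power,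
    mul_assoc, ← mul_assoc, power_mul_power hQ, supp_union_map, ← power_mul_power hQ, ← map_mul,
    ← map_mul, mul_assoc]

theorem star_gen (hQ : ∀ n, star (copy Q n) = copy Q n) (s : SInf) :
    star (gen Q s) = gen Q s⁻¹ := by
  rw [gen, gen_eq, star_mul, star_power hQ, star_regRep, supp_inv, map_inv ofPerm]

theorem gen_mul_ofSum (s : SInf) (z : Z2Inf) : gen Q s * regRep WreathInf (ofSum z) =
    regRep WreathInf (ofSum (permAction s z)) * gen Q s := by
  rw [gen_eq, mul_assoc, regRep_ofPerm_mul_ofSum, ← mul_assoc, ← mul_assoc,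
    (commute_power (fun n => commute_ofSum_copy _ n) _).eq]

theorem conj_gen (s t : SInf) : regRep WreathInf (ofPerm t) * gen Q s *
    star (regRep WreathInf (ofPerm t)) = gen Q (t * s * t⁻¹) := by
  rw [gen_eq, gen_eq, ← mul_assoc, regRep_ofPerm_mul_power, map_supp_conj, star_regRep, ← map_inv,
    map_mul, map_mul, map_mul, map_mul]
  simp only [mul_assoc]

theorem algebraMQ_eq : algebraMQ Q = generated (Set.range (gen Q) ∪
    Set.range fun z : Z2Inf => regRep WreathInf (ofSum z)) := by
  refine le_antisymm (generated_le (Set.union_subset ?_ ?_)) (generated_le (Set.union_subset ?_ ?_))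
  · exact Set.subset_union_left.trans (subset_generated _)
  · refine generated_le ?_
    rintro _ ⟨_, ⟨z, rfl⟩, rfl⟩
    exact subset_generated _ (Or.inr ⟨z, rfl⟩)
  · exact Set.subset_union_left.trans (subset_generated _)
  · rintro _ ⟨z, rfl⟩
    exact subset_generated _ (Or.inr (subset_generated _ ⟨ofSum z, ⟨z, rfl⟩, rfl⟩))

/-! ### Invariance of `M_Q` and the vectors `M_Q δ_1` -/

theorem gen_mem_algebraMQ (s : SInf) : gen Q s ∈ algebraMQ Q :=
  subset_generated _ (Or.inl ⟨s, rfl⟩)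

theorem ofSum_mem_algebraMQ (z : Z2Inf) : regRep WreathInf (ofSum z) ∈ algebraMQ Q := by
  rw [algebraMQ_eq]
  exact subset_generated _ (Or.inr ⟨z, rfl⟩)

theorem copy_mem_groupVN (n : ℕ+) : copy Q n ∈ (groupVN WreathInf).toStarSubalgebra :=
  sum_mem fun z _ => SMulMemClass.smul_mem (coeff Q z) (regRep_mem (ofSum (coord n z)))

theorem power_mem_groupVN (A : Finset ℕ+) : power Q A ∈ (groupVN WreathInf).toStarSubalgebra := by
  induction A using Finset.induction_on with
  | empty => rw [power_empty]; exact one_mem _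
  | insert n A hn ih => rw [power_insert_of_notMem hn]; exact mul_mem (copy_mem_groupVN n) ih

theorem algebraMQ_le : algebraMQ Q ≤ groupVN WreathInf := by
  rw [algebraMQ_eq]
  refine generated_le (Set.union_subset ?_ ?_)
  · rintro _ ⟨s, rfl⟩
    exact mul_mem (regRep_mem (ofPerm s)) (power_mem_groupVN (supp s))
  · rintro _ ⟨z, rfl⟩
    exact regRep_mem _

theorem isInvariant_algebraMQ : IsInvariant (algebraMQ Q) := by
  have hsum : ∀ z : Z2Inf, ∀ m ∈ algebraMQ Q, regRep WreathInf (ofSum z) * m *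
      star (regRep WreathInf (ofSum z)) ∈ algebraMQ Q := fun z m hm =>
    mul_mem (mul_mem (ofSum_mem_algebraMQ z) hm) (star_mem (ofSum_mem_algebraMQ z))
  have hperm : ∀ t : SInf, ∀ m ∈ algebraMQ Q, regRep WreathInf (ofPerm t) * m *
      star (regRep WreathInf (ofPerm t)) ∈ algebraMQ Q := by
    intro t m hm
    rw [algebraMQ_eq] at hm ⊢
    refine conj_mem_generated ?_ hm
    rintro _ (⟨s, rfl⟩ | ⟨z, rfl⟩)
    · rw [conj_gen]
      exact subset_generated _ (Or.inl ⟨_, rfl⟩)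
    · simp only [regRep_ofPerm_mul_ofSum, mul_assoc, regRep_mul_star, mul_one]
      exact subset_generated _ (Or.inr ⟨_, rfl⟩)
  intro g m hm
  rw [← SemidirectProduct.inl_left_mul_inr_right g, map_mul, star_mul]
  simpa only [mul_assoc] using hsum g.left _ (hperm g.right m hm)

/-- The closed span of the vectors `u_z s Q^{supp s} δ_1`. -/
def genSpace (Q : Ell2 Z2 →L[ℂ] Ell2 Z2) : Submodule ℂ (Ell2 WreathInf) :=
  (Submodule.span ℂ (Set.range fun p : Z2Inf × SInf =>
    regRep WreathInf (ofSum p.1) (gen Q p.2 (delta 1)))).topologicalClosure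

instance : CompleteSpace (genSpace Q) :=
  (Submodule.isClosed_topologicalClosure _).completeSpace_coe

theorem mem_genSpace (z : Z2Inf) (s : SInf) :
    regRep WreathInf (ofSum z) (gen Q s (delta 1)) ∈ genSpace Q :=
  Submodule.le_topologicalClosure _ (Submodule.subset_span ⟨(z, s), rfl⟩)

theorem genSpace_map {x : Ell2 WreathInf →L[ℂ] Ell2 WreathInf} {K : Submodule ℂ (Ell2 WreathInf)}
    (hK : IsClosed (K : Set (Ell2 WreathInf)))
    (h : ∀ z s, x (regRep WreathInf (ofSum z) (gen Q s (delta 1))) ∈ K)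
    {f : Ell2 WreathInf} (hf : f ∈ genSpace Q) : x f ∈ K := by
  have : genSpace Q ≤ K.comap x.toLinearMap := by
    refine Submodule.topologicalClosure_minimal _ (Submodule.span_le.2 ?_) (hK.preimage x.continuous)
    rintro _ ⟨⟨z, s⟩, rfl⟩
    exact h z s
  exact this hf

theorem isClosed_genSpace : IsClosed (genSpace Q : Set (Ell2 WreathInf)) :=
  Submodule.isClosed_topologicalClosure _

theorem ofSum_map_genSpace (z : Z2Inf) {f : Ell2 WreathInf} (hf : f ∈ genSpace Q) :
    regRep WreathInf (ofSum z) f ∈ genSpace Q := by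
  refine genSpace_map isClosed_genSpace (fun w s => ?_) hf
  rw [← mul_apply_eq_comp, ← map_mul, ← map_mul]
  exact mem_genSpace _ _

theorem power_map_mem {K : Submodule ℂ (Ell2 WreathInf)}
    (hK : ∀ z : Z2Inf, ∀ f ∈ K, regRep WreathInf (ofSum z) f ∈ K) (A : Finset ℕ+) :
    ∀ f ∈ K, power Q A f ∈ K := by
  induction A using Finset.induction_on with
  | empty =>
    intro f hf
    rwa [power_empty]
  | insert n A hn ih =>
    intro f hf
    rw [power_insert_of_notMem hn, mul_apply_eq_comp, copy_eq]
    exact add_mem (K.smul_mem _ (ih f hf)) (K.smul_mem _ (hK _ _ (ih f hf)))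

theorem gen_map_genSpace (hQ : ∀ n, copy Q n * copy Q n = copy Q n) (s : SInf)
    {f : Ell2 WreathInf} (hf : f ∈ genSpace Q) : gen Q s f ∈ genSpace Q := by
  refine genSpace_map isClosed_genSpace (fun z t => ?_) hf
  rw [← mul_apply_eq_comp, gen_mul_ofSum, mul_apply_eq_comp, ← mul_apply_eq_comp (gen Q s),
    gen_mul_gen hQ, mul_apply_eq_comp]
  refine ofSum_map_genSpace _ (power_map_mem (fun z f hf => ofSum_map_genSpace z hf) _ _ ?_)
  simpa using mem_genSpace 1 (s * t)

theorem apply_delta_one_mem_genSpace (hQ : ∀ n, copy Q n * copy Q n = copy Q n)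
    (hQ' : ∀ n, star (copy Q n) = copy Q n) {m : Ell2 WreathInf →L[ℂ] Ell2 WreathInf}
    (hm : m ∈ algebraMQ Q) : m (delta 1) ∈ genSpace Q := by
  rw [algebraMQ_eq] at hm
  refine generated_map_mem _ ?_ ?_ hm ?_
  · rintro _ (⟨s, rfl⟩ | ⟨z, rfl⟩) f hf
    · exact gen_map_genSpace hQ s hf
    · exact ofSum_map_genSpace z hf
  · rintro _ (⟨s, rfl⟩ | ⟨z, rfl⟩) f hf
    · rw [star_gen hQ']
      exact gen_map_genSpace hQ _ hf
    · simp only [star_regRep, ← map_inv]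
      exact ofSum_map_genSpace _ hf
  · have h1 : supp (1 : SInf) = ∅ := by
      ext n
      simp [mem_supp]
    simpa [gen, h1, power_empty] using mem_genSpace (Q := Q) 1 1

theorem ofSum_map_supportedOn (t : SInf) (z : Z2Inf) {f : Ell2 WreathInf}
    (hf : f ∈ supportedOn {g : WreathInf | g.right = t}) :
    regRep WreathInf (ofSum z) f ∈ supportedOn {g : WreathInf | g.right = t} :=
  regRep_mem_supportedOn (fun h hh => by simpa using hh) hf

theorem delta_ofPerm_mem (t : SInf) :
    delta (ofPerm t) ∈ supportedOn {g : WreathInf | g.right = t} :=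
  delta_mem_supportedOn (by simp)

theorem gen_delta_one (s : SInf) : gen Q s (delta 1) = power Q (supp s) (delta (ofPerm s)) := by
  rw [gen_eq, mul_apply_eq_comp, regRep_delta, mul_one]

/-- `s - s Q^{supp s}` is orthogonal to `M_Q`. -/
theorem inner_algebraMQ (hQ : ∀ n, copy Q n * copy Q n = copy Q n)
    (hQ' : ∀ n, star (copy Q n) = copy Q n) (s : SInf) {m : Ell2 WreathInf →L[ℂ] Ell2 WreathInf}
    (hm : m ∈ algebraMQ Q) :
    ⟪m (delta 1), delta (ofPerm s)⟫_ℂ = ⟪m (delta 1), gen Q s (delta 1)⟫_ℂ := by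
  set ξ := delta (ofPerm s) - gen Q s (delta 1) with hξ
  suffices h : m (delta 1) ∈ (ℂ ∙ ξ)ᗮ by
    rw [Submodule.mem_orthogonal_singleton_iff_inner_left, hξ, inner_sub_right, sub_eq_zero] at h
    exact h
  refine genSpace_map (x := 1) (Submodule.isClosed_orthogonal _) (fun z t => ?_)
    (apply_delta_one_mem_genSpace hQ hQ' hm)
  rw [Submodule.mem_orthogonal_singleton_iff_inner_left, hξ, gen_delta_one, gen_delta_one]
  change ⟪regRep WreathInf (ofSum z) (power Q (supp t) (delta (ofPerm t))), _⟫_ℂ = 0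
  -- For `t = s` the projection `Q^(supp s)` annihilates `ξ`. Otherwise the two vectors live on
  -- different cosets of `ℤ₂^∞`.
  by_cases hts : t = s
  · subst hts
    rw [← mul_apply_eq_comp (regRep _ _), (commute_power (fun n => commute_ofSum_copy z n) _).eq,
      mul_apply_eq_comp, star_mul_inner, star_power hQ', map_sub, ← mul_apply_eq_comp (power _ _),
      power_mul_power hQ, Finset.union_self, sub_self, inner_zero_right]
  · refine inner_eq_zero_of_disjoint (X := {g : WreathInf | g.right = t})
      (Y := {g : WreathInf | g.right = s}) ?_ ?_ ?_
    · rw [Set.disjoint_left]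
      rintro g rfl h
      exact hts h
    · exact ofSum_map_supportedOn t z
        (power_map_mem (fun z f hf => ofSum_map_supportedOn t z hf) _ _ (delta_ofPerm_mem t))
    · exact sub_mem (delta_ofPerm_mem s)
        (power_map_mem (fun z f hf => ofSum_map_supportedOn s z hf) _ _ (delta_ofPerm_mem s))

/-- When the product of the two copies is expanded, only the identity term fixes `g`; the condition
`i ≠ j` excludes cancellation in the mixed term. -/
theorem power_pair_apply {i j : ℕ+} (hij : i ≠ j) (g : WreathInf) :
    power Q {i, j} (delta g) g = coeff Q 1 ^ 2 := by
  classical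
  have ne : ∀ w : Z2Inf, w ≠ 1 → g ≠ ofSum w * g := by
    intro w hw h
    rw [eq_comm, mul_eq_right] at h
    exact hw (SemidirectProduct.inl_injective (h.trans (map_one _).symm))
  have hi : ∀ i, coord i (Multiplicative.ofAdd 1) ≠ 1 := by
    intro i h
    have := DFunLike.congr_fun (congrArg Multiplicative.toAdd h) i
    simp [coord] at this
  have h2 : coord i (Multiplicative.ofAdd 1) * coord j (Multiplicative.ofAdd 1) ≠ 1 := by
    intro h
    have := DFunLike.congr_fun (congrArg Multiplicative.toAdd h) i
    simp [coord, hij.symm] at this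
  have hp : power Q {i, j} = copy Q i * copy Q j := by
    rw [power_insert_of_notMem (by simpa using hij), ← insert_empty_eq j,
      power_insert_of_notMem (by simp), power_empty, mul_one]
  rw [hp, copy_eq, copy_eq, mul_apply_eq_comp]
  simp only [add_apply, smul_apply, one_apply_eq_self, map_add, map_smul, regRep_delta, ← mul_assoc,
    ← map_mul, ell2_add_apply, ell2_smul_apply, delta_apply,
    if_neg (ne _ (hi i)), if_neg (ne _ (hi j)), if_neg (ne _ h2)]
  simp [sq]

end Wreath

end GroupVN

end

/-! ### Proof of the proposition -/

theorem mainTheorem6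
    (Q : GroupVN.Ell2 GroupVN.Z2 →L[ℂ] GroupVN.Ell2 GroupVN.Z2)
    (hQmem : Q ∈ GroupVN.groupVN GroupVN.Z2) (hQ : IsStarProjection Q)
    (hQ0 : Q ≠ 0) (hQ1 : Q ≠ 1) :
    GroupVN.algebraMQ Q ≤ GroupVN.groupVN GroupVN.WreathInf ∧
    GroupVN.IsInvariant (GroupVN.algebraMQ Q) ∧
    (¬ ∃ N : Subgroup GroupVN.WreathInf, N.Normal ∧
      GroupVN.algebraMQ Q = GroupVN.subgroupVN N) ∧
    (∃! E : (GroupVN.groupVN GroupVN.WreathInf).toStarSubalgebra →ₗ[ℂ]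
        (GroupVN.algebraMQ Q).toStarSubalgebra,
      GroupVN.IsCondExp (GroupVN.algebraMQ Q) E) ∧
    ∀ E : (GroupVN.groupVN GroupVN.WreathInf).toStarSubalgebra →ₗ[ℂ]
        (GroupVN.algebraMQ Q).toStarSubalgebra,
      GroupVN.IsCondExp (GroupVN.algebraMQ Q) E →
      (E ⟨GroupVN.regRep GroupVN.WreathInf (GroupVN.ofPerm (GroupVN.transposition 1 2)),
          GroupVN.regRep_mem _⟩ :
        GroupVN.Ell2 GroupVN.WreathInf →L[ℂ] GroupVN.Ell2 GroupVN.WreathInf) =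
      GroupVN.regRep GroupVN.WreathInf (GroupVN.ofPerm (GroupVN.transposition 1 2)) *
        GroupVN.power Q {1, 2} := by
  obtain ⟨h0, h1, h2⟩ := GroupVN.coeff_of_isStarProjection hQmem hQ hQ0 hQ1
  have hidem := GroupVN.copy_mul_self h0 h1
  have hstar := GroupVN.star_copy h0 h2
  have h12 : (1 : ℕ+) ≠ 2 := by decide
  have hsupp := GroupVN.supp_transposition h12
  have hdelta : GroupVN.regRep GroupVN.WreathInf (GroupVN.ofPerm (GroupVN.transposition 1 2))
      (GroupVN.delta 1) = GroupVN.delta (GroupVN.ofPerm (GroupVN.transposition 1 2)) := by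
    rw [GroupVN.regRep_delta, mul_one]
  refine ⟨GroupVN.algebraMQ_le, GroupVN.isInvariant_algebraMQ, ?_,
    GroupVN.existsUnique_isCondExp GroupVN.algebraMQ_le, fun E hE => ?_⟩
  · rintro ⟨N, -, hN⟩
    set s := GroupVN.transposition 1 2 with hs
    have hval : GroupVN.gen Q s (GroupVN.delta 1) (GroupVN.ofPerm s) = 1 / 4 := by
      rw [GroupVN.gen_delta_one, hsupp, GroupVN.power_pair_apply h12, h0]
      norm_num
    have hsN : GroupVN.ofPerm s ∈ N := by
      by_contra h
      have := GroupVN.apply_delta_one_mem_supportedOn (hN ▸ GroupVN.gen_mem_algebraMQ s) _ h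
      rw [hval] at this
      norm_num at this
    have hmem : GroupVN.regRep GroupVN.WreathInf (GroupVN.ofPerm s) ∈ GroupVN.algebraMQ Q := by
      rw [hN]
      exact GroupVN.subset_generated _ ⟨_, hsN, rfl⟩
    classical
    -- Taking `m = u_s` itself, the left side is `1` and the right side is the coefficient `1/4`.
    have := GroupVN.inner_algebraMQ hidem hstar s hmem
    rw [hdelta, GroupVN.inner_delta_left, GroupVN.inner_delta_left, hval, GroupVN.delta_apply,
      if_pos rfl] at this
    norm_num at this
  · rw [← hsupp]
    refine GroupVN.ext_delta_one (GroupVN.commute_rightShift GroupVN.algebraMQ_le (E _).2)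
      (GroupVN.commute_rightShift GroupVN.algebraMQ_le (GroupVN.gen_mem_algebraMQ _)) ?_
    rw [hE.apply_delta_one]
    refine (GroupVN.proj_eq_iff (GroupVN.apply_mem_cyclicSpace (GroupVN.gen_mem_algebraMQ _))).2
      fun m hm => ?_
    rw [← GroupVN.inner_algebraMQ hidem hstar _ hm, ← hdelta]
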